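/- Let $|0\rangle,|1\rangle,|2\rangle$ be the standard basis of $\mathbb{C}^3$, and write $|i\pm j\rangle=(|i\rangle\pm|j\rangle)/\sqrt2$. The nine domino states are the orthonormal product basis of $\mathbb{C}^3\otimes\mathbb{C}^3$ given by $$|\psi_0\rangle=|1\rangle|1\rangle,\quad |\psi_1^\pm\rangle=|0\rangle|0\pm1\rangle,\quad |\psi_2^\pm\rangle=|0\pm1\rangle|2\rangle,\quad |\psi_3^\pm\rangle=|2\rangle|1\pm2\rangle,\quad |\psi_4^\pm\rangle=|1\pm2\rangle|0\rangle .$$ For each $i\in\{1,2,3,4\}$ let $|\phi_i\rangle$ be one of $|\psi_i^+\rangle$ and $|\psi_i^-\rangle$, and let $|\bar\phi_i\rangle$ be the other one. Let $$\rho=\tfrac15\Big(|\psi_0\rangle\langle\psi_0|+\sum_{i=1}^4|\bar\phi_i\rangle\langle\bar\phi_i|\Big)$$ be the uniform mixture of the five domino states other than $|\phi_1\rangle,\dots,|\phi_4\rangle$. Then, for every such choice of signs, the five states in $S=\{|\phi_i\rangle\langle\phi_i| : i=1,\dots,4\}\cup\{\rho\}$ cannot be discriminated with asymptotic LOCC.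 Here a finite LOCC protocol consists of finitely many rounds; in each round one of the two parties applies a quantum instrument with finitely many outcomes to their own (finite-dimensional) register and communicates the outcome to the other party, each step may depend on all earlier outcomes, and at the end the result of the protocol is determined by the communicated outcomes. A measurement can be implemented with asymptotic LOCC if it is the limit of measurements implemented by a sequence of finite LOCC protocols. The states in $S$ can be discriminated with asymptotic LOCC if some measurement that can be implemented with asymptotic LOCC identifies each state of $S$ with probability one. -/

import Mathlib

open scoped Kronecker

noncomputable section

/-- A finite LOCC protocol for two parties holding the registers `ℂ^dA` and `ℂ^dB`, whose classical
result is an element of `ι`.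

* `halt o`: the parties stop and announce the result `o`.
* `alice m d r K hK next`: Alice applies a quantum instrument with outcomes `j : Fin m` to her
  register and sends `j` to Bob; the completely positive map of the outcome `j` is
  `X ↦ ∑ k, K j k * X * (K j k)ᴴ`, from operators on `ℂ^dA` to operators on `ℂ^(d j)`, and `hK` says
  that the sum over `j` of these maps preserves the trace. The parties then follow `next j`.
* `bob m d r K hK next`: the same with the roles of the parties exchanged.

A protocol is a well-founded tree with finite branching, so it has finitely many rounds. Shared
randomness, ancillas, discarding of a subsystem and local channels are instruments of this form. -/
inductive LOCCProtocol (ι : Type) : ℕ → ℕ → Type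
  | halt {dA dB : ℕ} (o : ι) : LOCCProtocol ι dA dB
  | alice {dA dB : ℕ} (m : ℕ) (d r : Fin m → ℕ)
      (K : (j : Fin m) → Fin (r j) → Matrix (Fin (d j)) (Fin dA) ℂ)
      (hK : ∑ j, ∑ k, (K j k).conjTranspose * K j k = 1)
      (next : (j : Fin m) → LOCCProtocol ι (d j) dB) : LOCCProtocol ι dA dB
  | bob {dA dB : ℕ} (m : ℕ) (d r : Fin m → ℕ)
      (K : (j : Fin m) → Fin (r j) → Matrix (Fin (d j)) (Fin dB) ℂ)
      (hK : ∑ j, ∑ k, (K j k).conjTranspose * K j k = 1)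
      (next : (j : Fin m) → LOCCProtocol ι dA (d j)) : LOCCProtocol ι dA dB

/-- The measurement on `ℂ^dA ⊗ ℂ^dB` that a protocol implements: on the input state `ρ` the protocol
announces `i` with probability `tr (P.povm i * ρ)`. The operators are computed in the Heisenberg
picture. -/
def LOCCProtocol.povm {ι : Type} [DecidableEq ι] : {dA dB : ℕ} → LOCCProtocol ι dA dB →
    ι → Matrix (Fin dA × Fin dB) (Fin dA × Fin dB) ℂ
  | _, _, .halt o => fun i => if i = o then 1 else 0
  | _, dB, .alice _ _ _ K _ next => fun i => ∑ j, ∑ k,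
      (K j k ⊗ₖ (1 : Matrix (Fin dB) (Fin dB) ℂ)).conjTranspose * (next j).povm i *
        (K j k ⊗ₖ (1 : Matrix (Fin dB) (Fin dB) ℂ))
  | dA, _, .bob _ _ _ K _ next => fun i => ∑ j, ∑ k,
      ((1 : Matrix (Fin dA) (Fin dA) ℂ) ⊗ₖ K j k).conjTranspose * (next j).povm i *
        ((1 : Matrix (Fin dA) (Fin dA) ℂ) ⊗ₖ K j k)

/-- The measurement `M` can be implemented with asymptotic LOCC: some sequence of finite LOCC
protocols implements it with vanishing error. A limit of POVMs is a POVM, so `M` is then one. -/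
def IsAsymptoticLOCC {ι : Type} [DecidableEq ι] {dA dB : ℕ}
    (M : ι → Matrix (Fin dA × Fin dB) (Fin dA × Fin dB) ℂ) : Prop :=
  ∃ P : ℕ → LOCCProtocol ι dA dB,
    ∀ i, Filter.Tendsto (fun ν => (P ν).povm i) Filter.atTop (nhds (M i))

/-- The states `ρ i` can be discriminated with asymptotic LOCC: there is a measurement implementable
with asymptotic LOCC which on each input `ρ i` returns the index `i` with probability one. -/
def DiscriminableByAsymptoticLOCC {ι : Type} [DecidableEq ι] {dA dB : ℕ}
    (ρ : ι → Matrix (Fin dA × Fin dB) (Fin dA × Fin dB) ℂ) : Prop :=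
  ∃ M : ι → Matrix (Fin dA × Fin dB) (Fin dA × Fin dB) ℂ,
    IsAsymptoticLOCC M ∧ ∀ i, (M i * ρ i).trace = 1

/-- The standard basis vector `|i⟩` of `ℂ³`. -/
def ket (i : Fin 3) : Fin 3 → ℂ := Pi.single i 1

/-- The vector `|i ± j⟩ = (|i⟩ ± |j⟩) / √2` of `ℂ³`, the sign being `s`. -/
def ketSum (i j : Fin 3) (s : ℤˣ) : Fin 3 → ℂ :=
  ((√2 : ℝ) : ℂ)⁻¹ • (ket i + ((s : ℤ) : ℂ) • ket j)

/-- The product vector `|u⟩|v⟩` of `ℂ³ ⊗ ℂ³`. -/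
def prodKet (u v : Fin 3 → ℂ) : Fin 3 × Fin 3 → ℂ := fun p => u p.1 * v p.2

/-- The rank-one operator `|ψ⟩⟨ψ|`. -/
def proj (ψ : Fin 3 × Fin 3 → ℂ) : Matrix (Fin 3 × Fin 3) (Fin 3 × Fin 3) ℂ :=
  Matrix.vecMulVec ψ (star ψ)

/-- The domino state `|ψ₀⟩ = |1⟩|1⟩`. -/
def domino₀ : Fin 3 × Fin 3 → ℂ := prodKet (ket 1) (ket 1)

/-- The domino states `|ψ₁^±⟩, |ψ₂^±⟩, |ψ₃^±⟩, |ψ₄^±⟩`, here numbered from `0` to `3`, with the sign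
`s`. -/
def domino (i : Fin 4) (s : ℤˣ) : Fin 3 × Fin 3 → ℂ :=
  match i with
  | 0 => prodKet (ket 0) (ketSum 0 1 s)
  | 1 => prodKet (ketSum 0 1 s) (ket 2)
  | 2 => prodKet (ket 2) (ketSum 1 2 s)
  | 3 => prodKet (ketSum 1 2 s) (ket 0)

/-- For a choice of signs `s`: the four pure domino states with these signs (at `some i`) and the
uniform mixture of the remaining five domino states (at `none`). -/
def dominoStates (s : Fin 4 → ℤˣ) :
    Option (Fin 4) → Matrix (Fin 3 × Fin 3) (Fin 3 × Fin 3) ℂ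
  | some i => proj (domino i (s i))
  | none => (1 / 5 : ℂ) • (proj domino₀ + ∑ i, proj (domino i (-s i)))

end

open scoped Kronecker ComplexOrder
open Matrix Finset

noncomputable section

/-! Along a branch of a protocol the accumulated effect is a product `a ⊗ₖ b` of positive matrices.
If what follows discriminates well, every `φ_i` must stay almost orthogonal, in the form of `a ⊗ₖ
b`, to each domino state in the mixture (`norm_braket_domino_sq_le`). On product vectors the form
factorises; when `b` is nearly scalar its factor is bounded below for suitable pairs, so the factor
of `a` is small. The domino pattern supplies enough pairs to kill all off-diagonal entries of `a`
and equalise its diagonal: `a` is nearly scalar too (`nearScalar_left_of_error_lt`, and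
symmetrically for `b`).

This rules out gradual drift. Only one party acts at a time, so after each step the other factor is
still nearly scalar; the branch then either already errs by a fixed fraction of its weight or is
nearly scalar again, with the same tolerance. A nearly scalar leaf errs because one answer fits
several states. Induction on the tree (`LOCCProtocol.le_discriminationError`) gives an error bound
independent of the number of rounds, which therefore survives limits. -/

/-- The sesquilinear form `⟨x|W|y⟩` of a matrix. -/
def braket {n : Type*} [Fintype n] (W : Matrix n n ℂ) (x y : n → ℂ) : ℂ := star x ⬝ᵥ W *ᵥ y

/-! ### Positive semidefinite forms and the error functional. -/

section General

variable {n : Type*} [Fintype n]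

theorem braket_add (V W : Matrix n n ℂ) (x y : n → ℂ) :
    braket (V + W) x y = braket V x y + braket W x y := by
  simp [braket, add_mulVec]

theorem braket_sum {κ : Type*} (t : Finset κ) (W : κ → Matrix n n ℂ) (x y : n → ℂ) :
    braket (∑ j ∈ t, W j) x y = ∑ j ∈ t, braket (W j) x y := by
  simp [braket, sum_mulVec, dotProduct_sum]

theorem braket_self_re_nonneg {W : Matrix n n ℂ} (hW : W.PosSemidef) (x : n → ℂ) :
    0 ≤ (braket W x x).re :=
  hW.re_dotProduct_nonneg x

theorem trace_mul_vecMulVec_star (W : Matrix n n ℂ) (x : n → ℂ) :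
    (W * vecMulVec x (star x)).trace = braket W x x := by
  rw [mul_vecMulVec, trace_vecMulVec, dotProduct_comm, braket]

theorem dotProduct_star_self_eq_sum (x : n → ℂ) :
    star x ⬝ᵥ x = ((∑ k, ‖x k‖ ^ 2 : ℝ) : ℂ) := by
  simp [dotProduct, Complex.conj_mul']

theorem norm_dotProduct_star_sq_le (x y : n → ℂ) :
    ‖star x ⬝ᵥ y‖ ^ 2 ≤ (∑ k, ‖x k‖ ^ 2) * ∑ k, ‖y k‖ ^ 2 := by
  calc ‖star x ⬝ᵥ y‖ ^ 2 ≤ (∑ k, ‖x k‖ * ‖y k‖) ^ 2 := by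
        gcongr
        refine (norm_sum_le _ _).trans (le_of_eq ?_)
        simp
    _ ≤ _ := sum_mul_sq_le_sq_mul_sq _ _ _

theorem braket_conjTranspose_mul {m : Type*} [Fintype m] (B : Matrix m n ℂ) (x y : n → ℂ) :
    braket (Bᴴ * B) x y = star (B *ᵥ x) ⬝ᵥ (B *ᵥ y) := by
  rw [braket, ← mulVec_mulVec, dotProduct_mulVec, star_mulVec]

open scoped MatrixOrder Matrix.Norms.L2Operator in
theorem PosSemidef.exists_eq_conjTranspose_mul_self {W : Matrix n n ℂ} (hW : W.PosSemidef) :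
    ∃ B : Matrix n n ℂ, W = Bᴴ * B := by
  classical
  exact CStarAlgebra.nonneg_iff_eq_star_mul_self.mp hW.nonneg

/-- The Cauchy-Schwarz inequality for the form of a positive semidefinite matrix. -/
theorem norm_braket_sq_le {W : Matrix n n ℂ} (hW : W.PosSemidef) (x y : n → ℂ) :
    ‖braket W x y‖ ^ 2 ≤ (braket W x x).re * (braket W y y).re := by
  obtain ⟨B, rfl⟩ := PosSemidef.exists_eq_conjTranspose_mul_self hW
  simp only [braket_conjTranspose_mul]
  rw [dotProduct_star_self_eq_sum, dotProduct_star_self_eq_sum, Complex.ofReal_re,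
    Complex.ofReal_re]
  exact norm_dotProduct_star_sq_le _ _

/-- With `W = Bᴴ * B` the trace is the sum of the squared entries of `B`; Cauchy-Schwarz is applied
to each row. -/
theorem braket_self_re_le_trace {W : Matrix n n ℂ} (hW : W.PosSemidef) {x : n → ℂ}
    (hx : ∑ k, ‖x k‖ ^ 2 = 1) : (braket W x x).re ≤ W.trace.re := by
  obtain ⟨B, rfl⟩ := PosSemidef.exists_eq_conjTranspose_mul_self hW
  have htr : (Bᴴ * B).trace.re = ∑ k, ∑ l, ‖B k l‖ ^ 2 := by
    rw [trace_mul_comm]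
    simp only [trace, diag_apply, mul_apply, conjTranspose_apply, Complex.re_sum]
    refine sum_congr rfl fun k _ => sum_congr rfl fun l _ => ?_
    rw [Complex.star_def, Complex.mul_conj']
    norm_cast
  rw [htr, braket_conjTranspose_mul, dotProduct_star_self_eq_sum, Complex.ofReal_re]
  refine sum_le_sum fun k _ => ?_
  have h := norm_dotProduct_star_sq_le (star (B k)) x
  rw [hx, mul_one, star_star] at h
  simpa [mulVec] using h

/-- The probability of a wrong answer, summed over the states `ρ i`, when the answer `j` has the
(possibly subnormalised) effect `W j`. -/
def discriminationError {ι : Type*} [Fintype ι] [DecidableEq ι] (ρ W : ι → Matrix n n ℂ) : ℝ :=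
  ∑ i, ∑ j ∈ univ.erase i, (W j * ρ i).trace.re

/-- Additivity lets the error of a protocol be split over its branches. -/
theorem discriminationError_sum {ι κ : Type*} [Fintype ι] [DecidableEq ι] (ρ : ι → Matrix n n ℂ)
    (t : Finset κ) (W : κ → ι → Matrix n n ℂ) :
    discriminationError ρ (fun i => ∑ k ∈ t, W k i) = ∑ k ∈ t, discriminationError ρ (W k) := by
  simp only [discriminationError, Matrix.sum_mul, trace_sum, Complex.re_sum]
  simp_rw [sum_comm (t := t)]

theorem discriminationError_eq {ι : Type*} [Fintype ι] [DecidableEq ι] (ρ W : ι → Matrix n n ℂ) :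
    discriminationError ρ W = ∑ i, (((∑ j, W j) * ρ i).trace.re - (W i * ρ i).trace.re) := by
  refine sum_congr rfl fun i _ => ?_
  rw [← add_sum_erase _ _ (mem_univ i)]
  simp [Matrix.sum_mul, trace_sum]

theorem sum_kronecker {κ l m p q : Type*} (t : Finset κ) (A : κ → Matrix l m ℂ)
    (B : Matrix p q ℂ) : (∑ j ∈ t, A j) ⊗ₖ B = ∑ j ∈ t, A j ⊗ₖ B := by
  ext i j
  simp [Matrix.sum_apply, Finset.sum_mul]

theorem kronecker_sum {κ l m p q : Type*} (t : Finset κ) (A : Matrix l m ℂ)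
    (B : κ → Matrix p q ℂ) : A ⊗ₖ (∑ j ∈ t, B j) = ∑ j ∈ t, A ⊗ₖ B j := by
  ext i j
  simp [Matrix.sum_apply, Finset.mul_sum]

end General

/-! ### Protocols implement POVMs. -/

section Protocol

variable {ι : Type} [DecidableEq ι]

theorem LOCCProtocol.povm_posSemidef {dA dB : ℕ} (P : LOCCProtocol ι dA dB) (i : ι) :
    (P.povm i).PosSemidef := by
  induction P with
  | halt o =>
    simp only [LOCCProtocol.povm]
    split
    · exact PosSemidef.one
    · exact PosSemidef.zero
  | alice m d r K hK next ih =>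
    simp only [LOCCProtocol.povm]
    exact posSemidef_sum _ fun j _ => posSemidef_sum _ fun k _ =>
      (ih j).conjTranspose_mul_mul_same _
  | bob m d r K hK next ih =>
    simp only [LOCCProtocol.povm]
    exact posSemidef_sum _ fun j _ => posSemidef_sum _ fun k _ =>
      (ih j).conjTranspose_mul_mul_same _

theorem LOCCProtocol.sum_povm [Fintype ι] {dA dB : ℕ} (P : LOCCProtocol ι dA dB) :
    ∑ i, P.povm i = 1 := by
  induction P with
  | halt o => simp [LOCCProtocol.povm]
  | @alice dA dB m d r K hK next ih =>
    simp only [LOCCProtocol.povm]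
    rw [sum_comm]
    simp_rw [sum_comm (s := univ (α := ι)), ← Matrix.sum_mul, ← Matrix.mul_sum, ih,
      Matrix.mul_one, conjTranspose_kronecker, ← mul_kronecker_mul, ← sum_kronecker, hK]
    simp
  | @bob dA dB m d r K hK next ih =>
    simp only [LOCCProtocol.povm]
    rw [sum_comm]
    simp_rw [sum_comm (s := univ (α := ι)), ← Matrix.sum_mul, ← Matrix.mul_sum, ih,
      Matrix.mul_one, conjTranspose_kronecker, ← mul_kronecker_mul, conjTranspose_one,
      Matrix.mul_one, ← kronecker_sum, hK]
    simp

end Protocol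

/-! ### Forms on the domino vectors. -/

theorem braket_kronecker_prodKet (a b : Matrix (Fin 3) (Fin 3) ℂ) (u v u' v' : Fin 3 → ℂ) :
    braket (a ⊗ₖ b) (prodKet u v) (prodKet u' v') = braket a u u' * braket b v v' := by
  simp only [braket, dotProduct, mulVec, prodKet, Pi.star_apply, star_mul', Fintype.sum_prod_type,
    kronecker_apply, Finset.mul_sum, Finset.sum_mul]
  simp only [Fin.sum_univ_three]
  ring

theorem braket_ket_ket (a : Matrix (Fin 3) (Fin 3) ℂ) (i j : Fin 3) :
    braket a (ket i) (ket j) = a i j := by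
  simp [braket, ket]

theorem star_ketSum (i j : Fin 3) (s : ℤˣ) : star (ketSum i j s) = ketSum i j s := by
  have h : ∀ k, star (ket k) = ket k := fun k => by rw [ket, ← Pi.single_star, star_one]
  simp only [ketSum, star_smul, star_add, h]
  simp

theorem ofReal_sqrt_two_inv_mul_self : (((√2 : ℝ) : ℂ)⁻¹) * ((√2 : ℝ) : ℂ)⁻¹ = 2⁻¹ := by
  rw [← mul_inv]
  norm_cast
  simp

theorem braket_ketSum_ket (a : Matrix (Fin 3) (Fin 3) ℂ) (i j k : Fin 3) (s : ℤˣ) :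
    braket a (ketSum i j s) (ket k) =
      ((√2 : ℝ) : ℂ)⁻¹ * (a i k + ((s : ℤ) : ℂ) * a j k) := by
  rw [braket, star_ketSum]
  simp [ketSum, ket, add_dotProduct, smul_dotProduct]
  ring

theorem braket_ketSum_ketSum (a : Matrix (Fin 3) (Fin 3) ℂ) (i j k l : Fin 3) (s t : ℤˣ) :
    braket a (ketSum i j s) (ketSum k l t) =
      2⁻¹ * (a i k + ((t : ℤ) : ℂ) * a i l + ((s : ℤ) : ℂ) * (a j k + ((t : ℤ) : ℂ) * a j l)) := by
  rw [braket, star_ketSum, ← ofReal_sqrt_two_inv_mul_self]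
  simp [ketSum, ket, add_dotProduct, smul_dotProduct, mulVec_add, mulVec_smul]
  ring

theorem sum_norm_sq_prodKet (u v : Fin 3 → ℂ) :
    ∑ p, ‖prodKet u v p‖ ^ 2 = (∑ k, ‖u k‖ ^ 2) * ∑ k, ‖v k‖ ^ 2 := by
  simp [prodKet, Fintype.sum_prod_type, mul_pow, Finset.sum_mul_sum]

theorem sum_norm_sq_ket (i : Fin 3) : ∑ k, ‖ket i k‖ ^ 2 = 1 := by
  simp [ket, Pi.single_apply, apply_ite]

theorem norm_intUnits_cast (s : ℤˣ) : ‖((s : ℤ) : ℂ)‖ = 1 := by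
  rcases Int.units_eq_one_or s with rfl | rfl <;> simp

theorem sum_norm_sq_ketSum {i j : Fin 3} (hij : i ≠ j) (s : ℤˣ) :
    ∑ k, ‖ketSum i j s k‖ ^ 2 = 1 := by
  have h := dotProduct_star_self_eq_sum (ketSum i j s)
  have h1 : star (ketSum i j s) ⬝ᵥ ketSum i j s = braket 1 (ketSum i j s) (ketSum i j s) := by
    rw [braket, one_mulVec]
  rw [h1, braket_ketSum_ketSum] at h
  rw [← Complex.ofReal_inj, ← h]
  rcases Int.units_eq_one_or s with rfl | rfl <;> simp [hij, hij.symm] <;> norm_num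

theorem sum_norm_sq_domino₀ : ∑ p, ‖domino₀ p‖ ^ 2 = 1 := by
  simp [domino₀, sum_norm_sq_prodKet, sum_norm_sq_ket]

theorem sum_norm_sq_domino (i : Fin 4) (s : ℤˣ) : ∑ p, ‖domino i s p‖ ^ 2 = 1 := by
  fin_cases i <;>
    simp [domino, sum_norm_sq_prodKet, sum_norm_sq_ket, sum_norm_sq_ketSum]

/-! ### Small error forces almost orthogonality. -/

theorem trace_mul_dominoStates_some (s : Fin 4 → ℤˣ)
    (W : Matrix (Fin 3 × Fin 3) (Fin 3 × Fin 3) ℂ) (i : Fin 4) :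
    (W * dominoStates s (some i)).trace = braket W (domino i (s i)) (domino i (s i)) :=
  trace_mul_vecMulVec_star _ _

theorem trace_mul_dominoStates_none (s : Fin 4 → ℤˣ)
    (W : Matrix (Fin 3 × Fin 3) (Fin 3 × Fin 3) ℂ) :
    (W * dominoStates s none).trace.re = 5⁻¹ * ((braket W domino₀ domino₀).re +
      ∑ i, (braket W (domino i (-s i)) (domino i (-s i))).re) := by
  have h : (W * dominoStates s none).trace = ((5⁻¹ : ℝ) : ℂ) * (braket W domino₀ domino₀ +
      ∑ i, braket W (domino i (-s i)) (domino i (-s i))) := by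
    simp only [dominoStates, proj, Matrix.mul_smul, trace_smul, Matrix.mul_add, trace_add,
      Matrix.mul_sum, trace_sum, trace_mul_vecMulVec_star]
    simp
  rw [h, Complex.re_ofReal_mul, Complex.add_re, Complex.re_sum]

theorem trace_mul_dominoStates_re_nonneg (s : Fin 4 → ℤˣ)
    {W : Matrix (Fin 3 × Fin 3) (Fin 3 × Fin 3) ℂ} (hW : W.PosSemidef) (i : Option (Fin 4)) :
    0 ≤ (W * dominoStates s i).trace.re := by
  cases i with
  | none =>
    rw [trace_mul_dominoStates_none]
    have := sum_nonneg fun i (_ : i ∈ univ) => braket_self_re_nonneg hW (domino i (-s i))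
    have := braket_self_re_nonneg hW domino₀
    positivity
  | some i =>
    rw [trace_mul_dominoStates_some]
    exact braket_self_re_nonneg hW _

/-- The five domino states whose mixture is `dominoStates s none`. -/
def mixedDomino (s : Fin 4 → ℤˣ) : Option (Fin 4) → Fin 3 × Fin 3 → ℂ
  | none => domino₀
  | some i => domino i (-s i)

theorem braket_mixedDomino_re_le (s : Fin 4 → ℤˣ)
    {W : Matrix (Fin 3 × Fin 3) (Fin 3 × Fin 3) ℂ} (hW : W.PosSemidef) (i : Option (Fin 4)) :
    (braket W (mixedDomino s i) (mixedDomino s i)).re ≤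
      5 * (W * dominoStates s none).trace.re := by
  have h : 5 * (W * dominoStates s none).trace.re =
      ∑ j, (braket W (mixedDomino s j) (mixedDomino s j)).re := by
    rw [trace_mul_dominoStates_none, Fintype.sum_option]
    simp only [mixedDomino]
    ring
  rw [h]
  exact single_le_sum (f := fun j => (braket W (mixedDomino s j) (mixedDomino s j)).re)
    (fun j _ => braket_self_re_nonneg hW _) (mem_univ i)

theorem sum_norm_sq_mixedDomino (s : Fin 4 → ℤˣ) (i : Option (Fin 4)) :
    ∑ p, ‖mixedDomino s i p‖ ^ 2 = 1 := by
  cases i with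
  | none => exact sum_norm_sq_domino₀
  | some i => exact sum_norm_sq_domino i _

theorem discriminationError_dominoStates_nonneg (s : Fin 4 → ℤˣ)
    {W : Option (Fin 4) → Matrix (Fin 3 × Fin 3) (Fin 3 × Fin 3) ℂ}
    (hW : ∀ i, (W i).PosSemidef) : 0 ≤ discriminationError (dominoStates s) W :=
  sum_nonneg fun i _ => sum_nonneg fun j _ => trace_mul_dominoStates_re_nonneg s (hW j) i

/-- Effects that discriminate the states well leave the states almost orthogonal. -/
theorem norm_braket_domino_sq_le (s : Fin 4 → ℤˣ)
    {W : Option (Fin 4) → Matrix (Fin 3 × Fin 3) (Fin 3 × Fin 3) ℂ}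
    (hW : ∀ i, (W i).PosSemidef) (i : Fin 4) (j : Option (Fin 4)) :
    ‖braket (∑ k, W k) (domino i (s i)) (mixedDomino s j)‖ ^ 2 ≤
      10 * (∑ k, W k).trace.re * discriminationError (dominoStates s) W := by
  set φ := domino i (s i) with hφ
  set ψ := mixedDomino s j
  -- `V` collects the answers wrong for `φ`, so its form is small at `φ`; `W (some i)` is wrong for
  -- the mixture, so its form is small at `ψ`. Cauchy-Schwarz bounds both cross terms.
  set V := ∑ k ∈ univ.erase (some i), W k with hV_def
  have hV : V.PosSemidef := posSemidef_sum _ fun k _ => hW k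
  have hsum : ∑ k, W k = V + W (some i) := (sum_erase_add _ _ (mem_univ _)).symm
  have herr : (braket V φ φ).re + (W (some i) * dominoStates s none).trace.re ≤
      discriminationError (dominoStates s) W := by
    have h1 : (braket V φ φ).re =
        ∑ k ∈ univ.erase (some i), (W k * dominoStates s (some i)).trace.re := by
      simp only [trace_mul_dominoStates_some, hV_def, braket_sum, Complex.re_sum, hφ]
    have h2 : (W (some i) * dominoStates s none).trace.re ≤
        ∑ k ∈ univ.erase none, (W k * dominoStates s none).trace.re :=
      single_le_sum (f := fun k => (W k * dominoStates s none).trace.re)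
        (fun k _ => trace_mul_dominoStates_re_nonneg s (hW k) _) (by simp)
    have h3 : ∀ k ∈ (univ : Finset (Fin 4)),
        0 ≤ ∑ l ∈ univ.erase (some k), (W l * dominoStates s (some k)).trace.re :=
      fun k _ => sum_nonneg fun l _ => trace_mul_dominoStates_re_nonneg s (hW l) _
    have h4 := single_le_sum h3 (mem_univ i)
    rw [discriminationError, Fintype.sum_option]
    linarith
  have hVψ := braket_self_re_le_trace hV (sum_norm_sq_mixedDomino s j)
  have hWφ := braket_self_re_le_trace (hW (some i)) (sum_norm_sq_domino i (s i))
  have hWψ := braket_mixedDomino_re_le s (hW (some i)) j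
  have hCV := norm_braket_sq_le hV φ ψ
  have hCW := norm_braket_sq_le (hW (some i)) φ ψ
  have h1 := braket_self_re_nonneg hV φ
  have h2 := braket_self_re_nonneg hV ψ
  have h3 := braket_self_re_nonneg (hW (some i)) φ
  have h4 := braket_self_re_nonneg (hW (some i)) ψ
  have hn := norm_add_le (braket V φ ψ) (braket (W (some i)) φ ψ)
  rw [hsum, braket_add, trace_add, Complex.add_re]
  set p := ‖braket V φ ψ‖
  set q := ‖braket (W (some i)) φ ψ‖
  set T := V.trace.re + (W (some i)).trace.re with hT
  have hp : p ^ 2 ≤ (braket V φ φ).re * T :=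
    hCV.trans (mul_le_mul_of_nonneg_left (by linarith) h1)
  -- The factor 5 undoes the weight 1/5 of `ψ` in the mixture.
  have hq : q ^ 2 ≤ T * (5 * (W (some i) * dominoStates s none).trace.re) :=
    hCW.trans (mul_le_mul (by linarith) hWψ h4 (by linarith))
  have hT0 : 0 ≤ T := by linarith
  calc _ ≤ (p + q) ^ 2 := by gcongr
    _ ≤ 2 * (p ^ 2 + q ^ 2) := add_sq_le
    _ ≤ 10 * T * ((braket V φ φ).re + (W (some i) * dominoStates s none).trace.re) := by
      nlinarith [mul_nonneg h1 hT0]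
    _ ≤ _ := by gcongr

/-! ### Nearly scalar matrices. -/

/-- The matrix `a` is a multiple of the identity up to an error of one percent of its trace. -/
structure NearScalar (a : Matrix (Fin 3) (Fin 3) ℂ) : Prop where
  off_diag : ∀ i j, i ≠ j → ‖a i j‖ ≤ a.trace.re / 100
  diag : ∀ i, ‖a i i - a 1 1‖ ≤ a.trace.re / 100

theorem nearScalar_one : NearScalar 1 where
  off_diag i j h := by norm_num [h]
  diag i := by norm_num

section NearScalar

variable {a : Matrix (Fin 3) (Fin 3) ℂ}

theorem trace_re_nonneg (ha : a.PosSemidef) : 0 ≤ a.trace.re :=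
  (Complex.nonneg_iff.mp ha.trace_nonneg).1

theorem NearScalar.le_norm_one_one (h : NearScalar a) : 0.32 * a.trace.re ≤ ‖a 1 1‖ := by
  have h0 := h.diag 0
  have h2 := h.diag 2
  have h1 := (norm_nonneg _).trans h0
  have : a.trace = 3 * a 1 1 + (a 0 0 - a 1 1) + (a 2 2 - a 1 1) := by
    rw [trace_fin_three]; ring
  have := (Complex.re_le_norm a.trace).trans (this ▸ norm_add₃_le)
  rw [norm_mul] at this
  norm_num at this
  linarith

theorem NearScalar.le_norm_diag (h : NearScalar a) (i : Fin 3) : 0.31 * a.trace.re ≤ ‖a i i‖ := by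
  have h0 := h.diag i
  have h1 := h.le_norm_one_one
  have h2 := norm_sub_norm_le (a 1 1) (a i i)
  rw [norm_sub_rev] at h2
  linarith

/-- Exactly one of `i`, `j` equals `k`, so a single diagonal entry dominates. -/
theorem NearScalar.le_norm_braket_ketSum_ket (h : NearScalar a) {i j k : Fin 3} (s : ℤˣ)
    (hijk : i = k ∧ j ≠ k ∨ i ≠ k ∧ j = k) :
    a.trace.re / 10 ≤ ‖braket a (ketSum i j s) (ket k)‖ := by
  have hs := norm_intUnits_cast s
  have h2 : (1 / 2 : ℝ) ≤ (√2)⁻¹ := by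
    rw [one_div]
    exact inv_anti₀ (by positivity) (Real.sqrt_le_iff.mpr (by norm_num))
  have key : a.trace.re / 5 ≤ ‖a i k + ((s : ℤ) : ℂ) * a j k‖ := by
    have h0 := (norm_nonneg _).trans (h.diag 0)
    rcases hijk with ⟨rfl, hj⟩ | ⟨hi, rfl⟩
    · have h1 := h.off_diag j i hj
      have h3 := norm_sub_le_norm_add (a i i) (((s : ℤ) : ℂ) * a j i)
      have h4 := h.le_norm_diag i
      rw [norm_mul, hs] at h3
      linarith
    · have h1 := h.off_diag i j hi
      have h3 := norm_sub_le_norm_add (((s : ℤ) : ℂ) * a j j) (a i j)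
      have h4 := h.le_norm_diag j
      rw [norm_mul, hs, add_comm] at h3
      linarith
  rw [braket_ketSum_ket, norm_mul, norm_inv, Complex.norm_real, Real.norm_of_nonneg (by positivity)]
  have := mul_le_mul_of_nonneg_right h2 (norm_nonneg (a i k + ((s : ℤ) : ℂ) * a j k))
  linarith

/-- The two vectors overlap only in `ket 1`, so `a 1 1` dominates. -/
theorem NearScalar.le_norm_braket_ketSum_ketSum (h : NearScalar a) (s t : ℤˣ) :
    a.trace.re / 10 ≤ ‖braket a (ketSum 0 1 s) (ketSum 1 2 t)‖ := by
  have hs := norm_intUnits_cast s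
  have ht := norm_intUnits_cast t
  have h0 := (norm_nonneg _).trans (h.diag 0)
  have h01 := h.off_diag 0 1 (by decide)
  have h02 := h.off_diag 0 2 (by decide)
  have h12 := h.off_diag 1 2 (by decide)
  have h11 := h.le_norm_one_one
  rw [braket_ketSum_ketSum, norm_mul]
  have e : ((s : ℤ) : ℂ) * a 1 1 = (a 0 1 + ((t : ℤ) : ℂ) * a 0 2 +
      ((s : ℤ) : ℂ) * (a 1 1 + ((t : ℤ) : ℂ) * a 1 2)) +
      (-a 0 1 + -(((t : ℤ) : ℂ) * a 0 2) + -(((s : ℤ) : ℂ) * (((t : ℤ) : ℂ) * a 1 2))) := by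
    ring
  have h1 := norm_add_le (a 0 1 + ((t : ℤ) : ℂ) * a 0 2 +
      ((s : ℤ) : ℂ) * (a 1 1 + ((t : ℤ) : ℂ) * a 1 2))
      (-a 0 1 + -(((t : ℤ) : ℂ) * a 0 2) + -(((s : ℤ) : ℂ) * (((t : ℤ) : ℂ) * a 1 2)))
  rw [← e] at h1
  have h2 := h1.trans (add_le_add_right norm_add₃_le _)
  simp only [norm_neg, norm_mul, hs, ht, one_mul] at h2
  norm_num
  linarith

/-- Between vectors of opposite sign, the form is half the difference of two diagonal entries, up to
off-diagonal terms. -/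
theorem nearScalar_of_norm_braket_le (ha : a.IsHermitian) (s t : ℤˣ)
    (h01 : ‖a 0 1‖ ≤ a.trace.re / 1000) (h20 : ‖a 2 0‖ ≤ a.trace.re / 1000)
    (h21 : ‖a 2 1‖ ≤ a.trace.re / 1000)
    (hs : ‖braket a (ketSum 0 1 s) (ketSum 0 1 (-s))‖ ≤ a.trace.re / 1000)
    (ht : ‖braket a (ketSum 1 2 t) (ketSum 1 2 (-t))‖ ≤ a.trace.re / 1000) : NearScalar a := by
  have hsymm : ∀ i j, ‖a i j‖ = ‖a j i‖ := fun i j => by rw [← ha.apply i j, norm_star]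
  have h0 := (norm_nonneg _).trans h01
  have h10 := hsymm 0 1 ▸ h01
  have h02 := hsymm 2 0 ▸ h20
  have h12 := hsymm 2 1 ▸ h21
  have key : ∀ (i j : Fin 3) (r : ℤˣ), ‖a i j‖ ≤ a.trace.re / 1000 → ‖a j i‖ ≤ a.trace.re / 1000 →
      ‖braket a (ketSum i j r) (ketSum i j (-r))‖ ≤ a.trace.re / 1000 →
      ‖a i i - a j j‖ ≤ a.trace.re / 100 := by
    intro i j r hij hji hb
    have hr := norm_intUnits_cast r
    have hr2 : ((r : ℤ) : ℂ) * ((r : ℤ) : ℂ) = 1 := by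
      rcases Int.units_eq_one_or r with rfl | rfl <;> simp
    have e : a i i - a j j = 2 * braket a (ketSum i j r) (ketSum i j (-r)) +
        ((r : ℤ) : ℂ) * a i j + -(((r : ℤ) : ℂ) * a j i) := by
      rw [braket_ketSum_ketSum]
      push_cast
      linear_combination (a j j) * hr2
    rw [e]
    refine norm_add₃_le.trans ?_
    simp only [norm_neg, norm_mul, hr, one_mul]
    norm_num
    linarith
  have hd0 := key 0 1 s h01 h10 hs
  have hd2 := key 1 2 t h12 h21 ht
  rw [norm_sub_rev] at hd2
  constructor
  · intro i j hij
    fin_cases i <;> fin_cases j <;> first | exact absurd rfl hij | (simp only; dsimp; linarith)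
  · intro i
    fin_cases i
    · exact hd0
    · simp; linarith
    · exact hd2

end NearScalar

/-! ### Small error and one nearly scalar factor make the other nearly scalar. -/

section Gap

variable {s : Fin 4 → ℤˣ} {a b : Matrix (Fin 3) (Fin 3) ℂ}
  {W : Option (Fin 4) → Matrix (Fin 3 × Fin 3) (Fin 3 × Fin 3) ℂ}

theorem norm_braket_mul_norm_braket_le (ha : a.PosSemidef) (hb : b.PosSemidef)
    (hW : ∀ i, (W i).PosSemidef) (hsum : ∑ i, W i = a ⊗ₖ b)
    (herr : discriminationError (dominoStates s) W < 1e-9 * (a.trace.re * b.trace.re))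
    (i : Fin 4) (j : Option (Fin 4)) {u v u' v' : Fin 3 → ℂ}
    (hi : domino i (s i) = prodKet u v) (hj : mixedDomino s j = prodKet u' v') :
    ‖braket a u u'‖ * ‖braket b v v'‖ ≤ 1e-4 * (a.trace.re * b.trace.re) := by
  have h := norm_braket_domino_sq_le s hW i j
  have hta := trace_re_nonneg ha
  have htb := trace_re_nonneg hb
  have him : a.trace.im = 0 := (Complex.nonneg_iff.mp ha.trace_nonneg).2.symm
  rw [hsum, hi, hj, braket_kronecker_prodKet, norm_mul, trace_kronecker, Complex.mul_re, him,
    zero_mul, sub_zero] at h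
  refine abs_le_of_sq_le_sq' ?_ (by positivity) |>.2
  refine h.trans ?_
  have h2 : 0 ≤ a.trace.re * b.trace.re := by positivity
  -- The constants match: `10 * 1e-9 = (1e-4) ^ 2`.
  nlinarith

theorem le_of_mul_le_of_le {x y α β : ℝ} (hβ : 0 < β) (hx : 0 ≤ x)
    (h : x * y ≤ 1e-4 * (α * β)) (hy : β / 10 ≤ y) : x ≤ α / 1000 := by
  have := mul_le_mul_of_nonneg_left hy hx
  refine le_of_mul_le_mul_right (a := β) ?_ hβ
  linarith

theorem nearScalar_left_of_error_lt (ha : a.PosSemidef) (hb : b.PosSemidef) (hbs : NearScalar b)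
    (hW : ∀ i, (W i).PosSemidef) (hsum : ∑ i, W i = a ⊗ₖ b)
    (herr : discriminationError (dominoStates s) W < 1e-9 * (a.trace.re * b.trace.re)) :
    NearScalar a := by
  have hta := trace_re_nonneg ha
  have htb := trace_re_nonneg hb
  have hpos := (discriminationError_dominoStates_nonneg s hW).trans_lt herr
  -- The strict inequality in `herr` excludes branches of zero weight.
  have htb' : 0 < b.trace.re := htb.lt_of_ne (by intro h; simp [← h] at hpos)
  have key {u v u' v' : Fin 3 → ℂ} (i : Fin 4) (j : Option (Fin 4))
      (hi : domino i (s i) = prodKet u v) (hj : mixedDomino s j = prodKet u' v')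
      (h : b.trace.re / 10 ≤ ‖braket b v v'‖) : ‖braket a u u'‖ ≤ a.trace.re / 1000 :=
    le_of_mul_le_of_le htb' (norm_nonneg _)
      (norm_braket_mul_norm_braket_le ha hb hW hsum herr i j hi hj) h
  have hd (k : Fin 3) : b.trace.re / 10 ≤ ‖braket b (ket k) (ket k)‖ := by
    rw [braket_ket_ket]
    linarith [hbs.le_norm_diag k]
  -- The first three pairs bound the off-diagonal entries. The last two pair a domino state with its
  -- sign-flipped partner on Alice's side and compare diagonal entries.
  have h01 := key 0 none rfl rfl (hbs.le_norm_braket_ketSum_ket (s 0) (by decide))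
  have h02 := key 0 (some 2) rfl rfl (hbs.le_norm_braket_ketSum_ketSum (s 0) (-s 2))
  have h21 := key 2 none rfl rfl (hbs.le_norm_braket_ketSum_ket (s 2) (by decide))
  have hs := key 1 (some 1) rfl rfl (hd 2)
  have ht := key 3 (some 3) rfl rfl (hd 0)
  rw [braket_ket_ket] at h01 h02 h21
  rw [← ha.isHermitian.apply, norm_star] at h02
  exact nearScalar_of_norm_braket_le ha.isHermitian (s 1) (s 3) h01 h02 h21 hs ht

theorem nearScalar_right_of_error_lt (ha : a.PosSemidef) (hb : b.PosSemidef) (has : NearScalar a)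
    (hW : ∀ i, (W i).PosSemidef) (hsum : ∑ i, W i = a ⊗ₖ b)
    (herr : discriminationError (dominoStates s) W < 1e-9 * (a.trace.re * b.trace.re)) :
    NearScalar b := by
  have hta := trace_re_nonneg ha
  have htb := trace_re_nonneg hb
  have hpos := (discriminationError_dominoStates_nonneg s hW).trans_lt herr
  have hta' : 0 < a.trace.re := hta.lt_of_ne (by intro h; simp [← h] at hpos)
  have key {u v u' v' : Fin 3 → ℂ} (i : Fin 4) (j : Option (Fin 4))
      (hi : domino i (s i) = prodKet u v) (hj : mixedDomino s j = prodKet u' v')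
      (h : a.trace.re / 10 ≤ ‖braket a u u'‖) : ‖braket b v v'‖ ≤ b.trace.re / 1000 :=
    le_of_mul_le_of_le hta' (norm_nonneg _)
      (by
        rw [mul_comm, mul_comm b.trace.re]
        exact norm_braket_mul_norm_braket_le ha hb hW hsum herr i j hi hj) h
  have hd (k : Fin 3) : a.trace.re / 10 ≤ ‖braket a (ket k) (ket k)‖ := by
    rw [braket_ket_ket]
    linarith [has.le_norm_diag k]
  have h21 := key 1 none rfl rfl (has.le_norm_braket_ketSum_ket (s 1) (by decide))
  have h20 := key 1 (some 3) rfl rfl (has.le_norm_braket_ketSum_ketSum (s 1) (-s 3))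
  have h01 := key 3 none rfl rfl (has.le_norm_braket_ketSum_ket (s 3) (by decide))
  have hs := key 0 (some 0) rfl rfl (hd 0)
  have ht := key 2 (some 2) rfl rfl (hd 2)
  rw [braket_ket_ket] at h01 h20 h21
  exact nearScalar_of_norm_braket_le hb.isHermitian (s 0) (s 2) h01 h20 h21 hs ht

end Gap

/-! ### Effects along a branch. -/

section Protocol

/-- The effects of the protocol `P` after the local operators `KA` and `KB`. -/
def LOCCProtocol.effect {ι : Type} [DecidableEq ι] {dA dB : ℕ} (P : LOCCProtocol ι dA dB)
    (KA : Matrix (Fin dA) (Fin 3) ℂ) (KB : Matrix (Fin dB) (Fin 3) ℂ) (i : ι) :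
    Matrix (Fin 3 × Fin 3) (Fin 3 × Fin 3) ℂ :=
  (KA ⊗ₖ KB)ᴴ * P.povm i * (KA ⊗ₖ KB)

variable {ι : Type} [DecidableEq ι] {dA dB : ℕ}

theorem LOCCProtocol.effect_posSemidef (P : LOCCProtocol ι dA dB)
    (KA : Matrix (Fin dA) (Fin 3) ℂ) (KB : Matrix (Fin dB) (Fin 3) ℂ) (i : ι) :
    (P.effect KA KB i).PosSemidef :=
  (P.povm_posSemidef i).conjTranspose_mul_mul_same _

theorem LOCCProtocol.sum_effect [Fintype ι] (P : LOCCProtocol ι dA dB)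
    (KA : Matrix (Fin dA) (Fin 3) ℂ) (KB : Matrix (Fin dB) (Fin 3) ℂ) :
    ∑ i, P.effect KA KB i = (KAᴴ * KA) ⊗ₖ (KBᴴ * KB) := by
  simp only [LOCCProtocol.effect]
  rw [← Matrix.sum_mul, ← Matrix.mul_sum, P.sum_povm, Matrix.mul_one, conjTranspose_kronecker,
    ← mul_kronecker_mul]

/-- Each Kraus operator is absorbed into Alice's accumulated operator, so branches keep their
product form and the induction closes. -/
theorem LOCCProtocol.effect_alice {m : ℕ} {d r : Fin m → ℕ}
    (K : (j : Fin m) → Fin (r j) → Matrix (Fin (d j)) (Fin dA) ℂ)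
    (hK : ∑ j, ∑ k, (K j k).conjTranspose * K j k = 1)
    (next : (j : Fin m) → LOCCProtocol ι (d j) dB)
    (KA : Matrix (Fin dA) (Fin 3) ℂ) (KB : Matrix (Fin dB) (Fin 3) ℂ) (i : ι) :
    (LOCCProtocol.alice m d r K hK next).effect KA KB i =
      ∑ j, ∑ k, (next j).effect (K j k * KA) KB i := by
  simp only [LOCCProtocol.effect, LOCCProtocol.povm, Matrix.mul_sum, Matrix.sum_mul]
  refine sum_congr rfl fun j _ => sum_congr rfl fun k _ => ?_
  have h : (K j k * KA) ⊗ₖ KB = (K j k ⊗ₖ (1 : Matrix (Fin dB) (Fin dB) ℂ)) * (KA ⊗ₖ KB) := by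
    rw [← mul_kronecker_mul, Matrix.one_mul]
  simp only [h, conjTranspose_mul, Matrix.mul_assoc]

theorem LOCCProtocol.effect_bob {m : ℕ} {d r : Fin m → ℕ}
    (K : (j : Fin m) → Fin (r j) → Matrix (Fin (d j)) (Fin dB) ℂ)
    (hK : ∑ j, ∑ k, (K j k).conjTranspose * K j k = 1)
    (next : (j : Fin m) → LOCCProtocol ι dA (d j))
    (KA : Matrix (Fin dA) (Fin 3) ℂ) (KB : Matrix (Fin dB) (Fin 3) ℂ) (i : ι) :
    (LOCCProtocol.bob m d r K hK next).effect KA KB i =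
      ∑ j, ∑ k, (next j).effect KA (K j k * KB) i := by
  simp only [LOCCProtocol.effect, LOCCProtocol.povm, Matrix.mul_sum, Matrix.sum_mul]
  refine sum_congr rfl fun j _ => sum_congr rfl fun k _ => ?_
  have h : KA ⊗ₖ (K j k * KB) = ((1 : Matrix (Fin dA) (Fin dA) ℂ) ⊗ₖ K j k) * (KA ⊗ₖ KB) := by
    rw [← mul_kronecker_mul, Matrix.one_mul]
  simp only [h, conjTranspose_mul, Matrix.mul_assoc]

theorem trace_conjTranspose_mul_self_eq_sum {m : ℕ} {d r : Fin m → ℕ} {D : ℕ}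
    (K : (j : Fin m) → Fin (r j) → Matrix (Fin (d j)) (Fin D) ℂ)
    (hK : ∑ j, ∑ k, (K j k).conjTranspose * K j k = 1) (L : Matrix (Fin D) (Fin 3) ℂ) :
    (Lᴴ * L).trace.re = ∑ j, ∑ k, ((K j k * L)ᴴ * (K j k * L)).trace.re := by
  have h : Lᴴ * L = ∑ j, ∑ k, (K j k * L)ᴴ * (K j k * L) := by
    have : ∀ j k, (K j k * L)ᴴ * (K j k * L) = Lᴴ * ((K j k)ᴴ * K j k) * L := fun j k => by
      simp only [conjTranspose_mul, Matrix.mul_assoc]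
    simp only [this, ← Matrix.mul_sum, ← Matrix.sum_mul, hK, Matrix.mul_one]
  rw [h]
  simp only [trace_sum, Complex.re_sum]

end Protocol

/-! ### The uniform error bound. -/

section Bound

variable {a b : Matrix (Fin 3) (Fin 3) ℂ}

theorem NearScalar.le_braket_ket_re (h : NearScalar a) (ha : a.PosSemidef) (i : Fin 3) :
    a.trace.re / 100 ≤ (braket a (ket i) (ket i)).re := by
  have h1 : ‖braket a (ket i) (ket i)‖ = (braket a (ket i) (ket i)).re :=
    congrArg Complex.re (Complex.norm_of_nonneg' (ha.dotProduct_mulVec_nonneg _))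
  have h2 := h.le_norm_diag i
  rw [← h1, braket_ket_ket]
  linarith [trace_re_nonneg ha]

theorem NearScalar.le_braket_ketSum_re (h : NearScalar a) (ha : a.PosSemidef) (s : ℤˣ) :
    a.trace.re / 100 ≤ (braket a (ketSum 0 1 s) (ketSum 0 1 s)).re := by
  have h0 := braket_self_re_nonneg ha (ketSum 0 1 s)
  rcases (trace_re_nonneg ha).eq_or_lt with ht | ht
  · rw [← ht]; simpa using h0
  have h1 := h.le_norm_braket_ketSum_ket (i := 0) (j := 1) (k := 1) s (by decide)
  have h2 := norm_braket_sq_le ha (ketSum 0 1 s) (ket 1)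
  have h3 := braket_self_re_le_trace ha (sum_norm_sq_ket 1)
  -- Cauchy-Schwarz against `ket 1` turns the lower bound `tr a / 10` on the cross term into `tr a /
  -- 100` on the diagonal one.
  have h4 := pow_le_pow_left₀ (by positivity) h1 2
  have h5 := mul_le_mul_of_nonneg_left h3 h0
  refine le_of_mul_le_mul_right (a := a.trace.re) ?_ ht
  nlinarith

theorem le_discriminationError_halt (s : Fin 4 → ℤˣ) (ha : a.PosSemidef) (hb : b.PosSemidef)
    (has : NearScalar a) (hbs : NearScalar b)
    {W : Option (Fin 4) → Matrix (Fin 3 × Fin 3) (Fin 3 × Fin 3) ℂ}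
    (hW : ∀ i, (W i).PosSemidef) (o : Option (Fin 4)) (ho : W o = a ⊗ₖ b) :
    1e-9 * (a.trace.re * b.trace.re) ≤ discriminationError (dominoStates s) W := by
  have key : ∀ i, i ≠ o → (W o * dominoStates s i).trace.re ≤
      discriminationError (dominoStates s) W := by
    intro i hi
    have h1 : ∀ i ∈ univ, 0 ≤ ∑ j ∈ univ.erase i, (W j * dominoStates s i).trace.re :=
      fun i _ => sum_nonneg fun j _ => trace_mul_dominoStates_re_nonneg s (hW j) i
    refine le_trans ?_ (single_le_sum h1 (mem_univ i))
    exact single_le_sum (f := fun j => (W j * dominoStates s i).trace.re)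
      (fun j _ => trace_mul_dominoStates_re_nonneg s (hW j) i) (by simp [hi.symm])
  have hta := trace_re_nonneg ha
  have htb := trace_re_nonneg hb
  have hab := mul_nonneg hta htb
  have re_mul : ∀ u v, (braket a u u * braket b v v).re = (braket a u u).re * (braket b v v).re := by
    intro u v
    have : (braket a u u).im = 0 := (Complex.nonneg_iff.mp (ha.dotProduct_mulVec_nonneg u)).2.symm
    rw [Complex.mul_re, this, zero_mul, sub_zero]
  -- Whatever is announced, it is wrong for `some 0` or for `some 1`.
  by_cases h0 : o = some 0
  · have h := key (some 1) (by simp [h0])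
    rw [ho, trace_mul_dominoStates_some, domino, braket_kronecker_prodKet, re_mul] at h
    have := mul_le_mul (has.le_braket_ketSum_re ha (s 1)) (hbs.le_braket_ket_re hb 2)
      (by positivity) (braket_self_re_nonneg ha _)
    linarith
  · have h := key (some 0) (Ne.symm h0)
    rw [ho, trace_mul_dominoStates_some, domino, braket_kronecker_prodKet, re_mul] at h
    have := mul_le_mul (has.le_braket_ket_re ha 0) (hbs.le_braket_ketSum_re hb (s 0))
      (by positivity) (braket_self_re_nonneg ha _)
    linarith

/-- A finite LOCC protocol that starts from nearly trivial local operators errs with a probability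
bounded away from zero. -/
theorem LOCCProtocol.le_discriminationError (s : Fin 4 → ℤˣ) {dA dB : ℕ}
    (P : LOCCProtocol (Option (Fin 4)) dA dB) :
    ∀ (KA : Matrix (Fin dA) (Fin 3) ℂ) (KB : Matrix (Fin dB) (Fin 3) ℂ),
      NearScalar (KAᴴ * KA) → NearScalar (KBᴴ * KB) →
      1e-9 * ((KAᴴ * KA).trace.re * (KBᴴ * KB).trace.re) ≤
        discriminationError (dominoStates s) (P.effect KA KB) := by
  induction P with
  | halt o =>
    intro KA KB hA hB
    refine le_discriminationError_halt s (posSemidef_conjTranspose_mul_self _)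
      (posSemidef_conjTranspose_mul_self _) hA hB (LOCCProtocol.effect_posSemidef _ _ _) o ?_
    simp only [LOCCProtocol.effect, LOCCProtocol.povm, if_true, Matrix.mul_one]
    rw [conjTranspose_kronecker, ← mul_kronecker_mul]
  | alice m d r K hK next ih =>
    intro KA KB hA hB
    have he : (LOCCProtocol.alice m d r K hK next).effect KA KB =
        fun i => ∑ j, ∑ k, (next j).effect (K j k * KA) KB i :=
      funext fun i => LOCCProtocol.effect_alice K hK next KA KB i
    rw [he, trace_conjTranspose_mul_self_eq_sum K hK, discriminationError_sum, Finset.sum_mul,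
      Finset.mul_sum]
    refine sum_le_sum fun j _ => ?_
    rw [discriminationError_sum, Finset.sum_mul, Finset.mul_sum]
    refine sum_le_sum fun k _ => ?_
    -- A branch below the bound would be nearly scalar, and the induction hypothesis would then put
    -- it above the bound.
    by_contra! hlt
    refine hlt.not_ge (ih j _ _ ?_ hB)
    exact nearScalar_left_of_error_lt (posSemidef_conjTranspose_mul_self _)
      (posSemidef_conjTranspose_mul_self _) hB ((next j).effect_posSemidef _ _)
      ((next j).sum_effect _ _) hlt
  | bob m d r K hK next ih =>
    intro KA KB hA hB
    have he : (LOCCProtocol.bob m d r K hK next).effect KA KB =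
        fun i => ∑ j, ∑ k, (next j).effect KA (K j k * KB) i :=
      funext fun i => LOCCProtocol.effect_bob K hK next KA KB i
    rw [he, trace_conjTranspose_mul_self_eq_sum K hK, discriminationError_sum, Finset.mul_sum,
      Finset.mul_sum]
    refine sum_le_sum fun j _ => ?_
    rw [discriminationError_sum, Finset.mul_sum, Finset.mul_sum]
    refine sum_le_sum fun k _ => ?_
    by_contra! hlt
    refine hlt.not_ge (ih j _ _ hA ?_)
    exact nearScalar_right_of_error_lt (posSemidef_conjTranspose_mul_self _)
      (posSemidef_conjTranspose_mul_self _) hA ((next j).effect_posSemidef _ _)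
      ((next j).sum_effect _ _) hlt

theorem trace_dominoStates (s : Fin 4 → ℤˣ) (i : Option (Fin 4)) :
    (dominoStates s i).trace.re = 1 := by
  have h : ∀ x : Fin 3 × Fin 3 → ℂ, ∑ k, ‖x k‖ ^ 2 = 1 →
      (braket (1 : Matrix (Fin 3 × Fin 3) (Fin 3 × Fin 3) ℂ) x x).re = 1 := fun x hx => by
    rw [braket, one_mulVec, dotProduct_star_self_eq_sum, hx]
    simp
  rw [← Matrix.one_mul (dominoStates s i)]
  cases i with
  | none =>
    rw [trace_mul_dominoStates_none, h _ sum_norm_sq_domino₀]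
    simp only [h _ (sum_norm_sq_domino _ _)]
    norm_num
  | some i => rw [trace_mul_dominoStates_some, h _ (sum_norm_sq_domino _ _)]

/-- At the root both local operators are the identity of trace 3, whence `9e-9`. -/
theorem LOCCProtocol.le_five_sub_sum (s : Fin 4 → ℤˣ) (P : LOCCProtocol (Option (Fin 4)) 3 3) :
    9e-9 ≤ 5 - ∑ i, (P.povm i * dominoStates s i).trace.re := by
  have hone : NearScalar ((1 : Matrix (Fin 3) (Fin 3) ℂ)ᴴ * 1) := by simpa using nearScalar_one
  have h := P.le_discriminationError s 1 1 hone hone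
  have he : P.effect 1 1 = P.povm := by
    ext1 i
    simp [LOCCProtocol.effect]
  rw [he, discriminationError_eq, P.sum_povm] at h
  simp only [Matrix.one_mul, trace_dominoStates, sum_sub_distrib] at h
  norm_num at h ⊢
  exact h

end Bound

end

theorem mainTheorem4 (s : Fin 4 → ℤˣ) :
    ¬ DiscriminableByAsymptoticLOCC (dA := 3) (dB := 3) (dominoStates s) := by
  rintro ⟨M, ⟨P, hP⟩, hM⟩
  have hlim : Filter.Tendsto
      (fun ν => 5 - ∑ i, (((P ν).povm i) * dominoStates s i).trace.re) Filter.atTop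
      (nhds (5 - ∑ i, (M i * dominoStates s i).trace.re)) := by
    refine tendsto_const_nhds.sub (tendsto_finsetSum _ fun i _ => ?_)
    have hc : Continuous fun W : Matrix (Fin 3 × Fin 3) (Fin 3 × Fin 3) ℂ =>
        (W * dominoStates s i).trace.re := by fun_prop
    exact (hc.tendsto _).comp (hP i)
  -- The error is continuous in the POVM, so the uniform bound passes to `M`, whose error would be
  -- `5 - 5 = 0`.
  have h := ge_of_tendsto' hlim fun ν => (P ν).le_five_sub_sum s
  simp only [hM] at h
  norm_num at h
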